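/- For covariate vectors $x_1,\dots,x_n\in\mathbb{R}^p$ let \[ H(\beta)=\sum_{i=1}^n b''(x_i^\top\beta)\,x_ix_i^\top,\qquad b(\theta)=\log(1+e^\theta),\quad b''(\theta)=\frac{e^\theta}{(1+e^\theta)^2}, \] be the negative Hessian of the logistic regression log-likelihood. For $J\subseteq\{1,\dots,p\}$ and $\beta\in\mathbb{R}^J$ (identified with the vector in $\mathbb{R}^p$ obtained by filling in zeros outside $J$), let $H_J(\beta)$ be the submatrix of $H(\beta)$ with rows and columns in $J$. Write $A\preceq B$ if $B-A$ is positive semidefinite, $\mathbf{I}_J$ for the identity matrix, and $\|\cdot\|$ for the spectral norm of a matrix. A vector is $q$-sparse if it has at most $q$ nonzero entries. For every $a_1,a_2,a_3>0$ there are constants $c_{\mathrm{sample}},c_{\mathrm{change}},c_{\mathrm{prob}}>0$, a (strictly) decreasing function $c_{\mathrm{lower}}:[0,\infty)\to(0,\infty)$ and a (strictly) increasing function $c_{\mathrm{upper}}:[0,\infty)\to(0,\infty)$, all depending only on $(a_1,a_2,a_3)$, such that the following holds for all integers $n,p\ge 2$ and $q\ge 1$. Let $X_1,\dots,X_n$ be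 i.i.d. random vectors in $\mathbb{R}^p$ such that (A1) $\mathbb{E}[(X_1^\top u)^2]\ge a_1$ for every $q$-sparse unit vector $u\in\mathbb{R}^p$; (A2) $\mathbb{E}[|X_1^\top u|^3]\le a_2$ for every $q$-sparse unit vector $u\in\mathbb{R}^p$; (A3) $|X_{1j}|\le a_3$ almost surely, for each $j\in\{1,\dots,p\}$. If \[ n\ge c_{\mathrm{sample}}\cdot q^3\log(p), \] then, for $H$ formed with $x_i=X_i$, the event that simultaneously for all $J$ with $|J|\le q$ and all $\beta,\beta'\in\mathbb{R}^J$ \[ c_{\mathrm{lower}}(\|\beta\|_2)\,\mathbf{I}_J\preceq\frac1n H_J(\beta)\preceq c_{\mathrm{upper}}(\|\beta\|_2)\,\mathbf{I}_J \quad\text{and}\quad \frac1n\|H_J(\beta)-H_J(\beta')\|\le c_{\mathrm{change}}\,\|\beta-\beta'\|_2 \] is measurable and has probability at least $1-\exp\{-c_{\mathrm{prob}}\,n/q^3\}$. -/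

import Mathlib

open MeasureTheory ProbabilityTheory

noncomputable section

namespace SparseLogistic

/-- The cumulant function `b(θ) = log (1 + e^θ)` of logistic regression. -/
def cumulant (θ : ℝ) : ℝ := Real.log (1 + Real.exp θ)

/-- The second derivative `b''(θ) = e^θ / (1 + e^θ)^2` of the cumulant function
(see `deriv_deriv_cumulant`). -/
def cumulantSecond (θ : ℝ) : ℝ := Real.exp θ / (1 + Real.exp θ) ^ 2

theorem deriv_deriv_cumulant : deriv (deriv cumulant) = cumulantSecond := by
  have hpos : ∀ θ : ℝ, 1 + Real.exp θ ≠ 0 := fun θ => by positivity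
  have h1 : deriv cumulant = fun θ => Real.exp θ / (1 + Real.exp θ) := by
    funext θ
    exact (((Real.hasDerivAt_exp θ).const_add 1).log (hpos θ)).deriv
  rw [h1]
  funext θ
  have h2 := (Real.hasDerivAt_exp θ).div ((Real.hasDerivAt_exp θ).const_add 1) (hpos θ)
  have h3 := h2.deriv
  have h4 : deriv (fun θ => Real.exp θ / (1 + Real.exp θ)) θ = _ := h3
  rw [h4, cumulantSecond]
  congr 1
  ring

/-- A vector is `q`-sparse if at most `q` of its entries are nonzero. -/
def IsSparse {p : ℕ} (q : ℕ) (u : EuclideanSpace ℝ (Fin p)) : Prop :=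
  (Finset.univ.filter fun j => u j ≠ 0).card ≤ q

/-- Sparse second and third moment conditions and boundedness of the entries, for a random
covariate vector `Z` in `ℝ^p` and sparsity level `q`.
By `bounded`, the integrands in the first two conditions are bounded almost surely, so that they
are integrable whenever `Z` is measurable. -/
structure CovariateAssumptions {Ω : Type*} [MeasurableSpace Ω] (μ : Measure Ω) {p : ℕ}
    (Z : Ω → EuclideanSpace ℝ (Fin p)) (q : ℕ) (a₁ a₂ a₃ : ℝ) : Prop where
  second_moment : ∀ u : EuclideanSpace ℝ (Fin p), ‖u‖ = 1 → IsSparse q u →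
    a₁ ≤ ∫ ω, (inner ℝ (Z ω) u) ^ 2 ∂μ
  third_moment : ∀ u : EuclideanSpace ℝ (Fin p), ‖u‖ = 1 → IsSparse q u →
    ∫ ω, |inner ℝ (Z ω) u| ^ 3 ∂μ ≤ a₂
  bounded : ∀ j : Fin p, ∀ᵐ ω ∂μ, |Z ω j| ≤ a₃

/-- The vector in `ℝ^p` obtained from `β ∈ ℝ^J` by filling in zeros outside `J`. -/
def extendZero {p : ℕ} (J : Finset (Fin p)) (β : EuclideanSpace ℝ J) :
    EuclideanSpace ℝ (Fin p) :=
  WithLp.toLp 2 fun j => if h : j ∈ J then β ⟨j, h⟩ else 0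

/-- The negative Hessian `H(β) = ∑ i, b''(xᵢᵀ β) xᵢ xᵢᵀ` of the logistic log-likelihood, for
covariate vectors `x₁, …, xₙ ∈ ℝ^p`. -/
def hessian {n p : ℕ} (x : Fin n → EuclideanSpace ℝ (Fin p)) (β : EuclideanSpace ℝ (Fin p)) :
    Matrix (Fin p) (Fin p) ℝ :=
  ∑ i, cumulantSecond (inner ℝ (x i) β) • Matrix.vecMulVec (x i).ofLp (x i).ofLp

/-- The submatrix `H_J(β)` of `H(β)` with rows and columns in `J`, for `β ∈ ℝ^J`. -/
def subHessian {n p : ℕ} (x : Fin n → EuclideanSpace ℝ (Fin p)) (J : Finset (Fin p))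
    (β : EuclideanSpace ℝ J) : Matrix J J ℝ :=
  (hessian x (extendZero J β)).submatrix Subtype.val Subtype.val

/-- The ordering `A ⪯ B` of the positive semidefinite cone. -/
def LoewnerLE {ι : Type*} [Fintype ι] (A B : Matrix ι ι ℝ) : Prop := (B - A).PosSemidef

/-- The spectral norm of a square matrix, i.e. its operator norm for the Euclidean norm. -/
def spectralNorm {ι : Type*} [Fintype ι] [DecidableEq ι] (A : Matrix ι ι ℝ) : ℝ :=
  ‖Matrix.toEuclideanCLM (n := ι) (𝕜 := ℝ) A‖

/-- For all `|J| ≤ q` and `β, β' ∈ ℝ^J`, the curvature bounds and the Lipschitz bound for the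
normalized Hessian hold. -/
def HessianConditions {n p : ℕ} (x : Fin n → EuclideanSpace ℝ (Fin p)) (q : ℕ)
    (cLower cUpper : ℝ → ℝ) (cChange : ℝ) : Prop :=
  ∀ J : Finset (Fin p), J.card ≤ q → ∀ β β' : EuclideanSpace ℝ J,
    LoewnerLE (cLower ‖β‖ • (1 : Matrix J J ℝ)) ((1 / (n : ℝ)) • subHessian x J β) ∧
    LoewnerLE ((1 / (n : ℝ)) • subHessian x J β) (cUpper ‖β‖ • (1 : Matrix J J ℝ)) ∧
    (1 / (n : ℝ)) * spectralNorm (subHessian x J β - subHessian x J β') ≤ cChange * ‖β - β'‖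

end SparseLogistic

end

namespace SparseLogistic

/-! The whole event follows from two bounds on the sample, uniform over `q`-sparse `u`: an upper
bound `n C ‖u‖³` on the empirical third absolute moment and a lower bound `n a ‖u‖²` on the second
(`hessianConditions_of_moments`). For the lower curvature bound, `b''` is even and decreasing in
`|t|`, so `b''(t) ≥ b''(R) (1 - |t| / R)`; summing against `(xᵢᵀv)²` leaves the second moment minus
a trilinear term, at most half of it once `R` is a large multiple of `‖β‖`. The upper bound uses
`b'' ≤ 1`, and the Lipschitz bound uses that `b''` is 1-Lipschitz together with the trilinear Hölder
inequality.

Both moment bounds need only be checked on a finite net of sparse vectors (`exists_netVec`).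
Rounding preserves sparsity of the difference, so the supremum of the third moments bounds itself
(`third_moment_of_net`), and the third moments in turn control the rounding error of the second
(`second_moment_of_net`).

For one direction, `|Xᵀu| ≤ a₃ √q` and Chernoff bounds give failure probability of order `exp(-c n /
q^(3/2))`. The logarithm of the net size is of order at most `q^(3/2) log p`, so the union bound
costs `n ≳ q³ log p` (`card_net_mul_exp_le`). -/

/-! ### Shape and Lipschitz continuity of `b''`. -/

theorem cumulantSecond_pos (θ : ℝ) : 0 < cumulantSecond θ := by
  unfold cumulantSecond; positivity

theorem cumulantSecond_le_one (θ : ℝ) : cumulantSecond θ ≤ 1 := by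
  unfold cumulantSecond
  rw [div_le_one (by positivity)]
  nlinarith [Real.exp_pos θ]

theorem cumulantSecond_neg (θ : ℝ) : cumulantSecond (-θ) = cumulantSecond θ := by
  unfold cumulantSecond
  rw [Real.exp_neg]
  have := Real.exp_pos θ
  field_simp
  ring

theorem cumulantSecond_abs (θ : ℝ) : cumulantSecond |θ| = cumulantSecond θ := by
  rcases abs_cases θ with ⟨h, _⟩ | ⟨h, _⟩ <;> rw [h]
  exact cumulantSecond_neg θ

theorem strictAntiOn_cumulantSecond : StrictAntiOn cumulantSecond (Set.Ici 0) := by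
  intro s hs t _ hst
  have h1 : 1 ≤ Real.exp s := Real.one_le_exp hs
  have h2 : Real.exp s < Real.exp t := Real.exp_lt_exp.2 hst
  unfold cumulantSecond
  rw [div_lt_div_iff₀ (by positivity) (by positivity)]
  -- With `x = e^s` and `y = e^t`, the difference of the two sides is `(y - x)(xy - 1)`, and `xy >
  -- 1`.
  nlinarith [mul_pos (sub_pos.2 h2) (sub_pos.2 (lt_of_lt_of_le h2 (le_mul_of_one_le_left
    (Real.exp_pos t).le h1))), mul_pos (sub_pos.2 h2) (sub_pos.2 (lt_of_le_of_lt h1 h2)),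
    mul_nonneg (sub_nonneg.2 h1) (Real.exp_pos t).le]

theorem continuous_cumulantSecond : Continuous cumulantSecond := by
  unfold cumulantSecond
  exact Real.continuous_exp.div (by fun_prop) fun θ => by positivity

theorem abs_cumulantSecond_sub_le (s t : ℝ) :
    |cumulantSecond s - cumulantSecond t| ≤ |s - t| := by
  have hd (θ : ℝ) : HasDerivAt cumulantSecond
      ((Real.exp θ * (1 + Real.exp θ) ^ 2 - Real.exp θ * (2 * (1 + Real.exp θ) * Real.exp θ)) /
        ((1 + Real.exp θ) ^ 2) ^ 2) θ := by
    have h : HasDerivAt cumulantSecond _ θ :=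
      (Real.hasDerivAt_exp θ).div (((Real.hasDerivAt_exp θ).const_add 1).pow 2)
        (pow_ne_zero 2 (by positivity : 1 + Real.exp θ ≠ 0))
    refine h.congr_deriv ?_
    simp
  have hL : LipschitzWith 1 cumulantSecond := by
    refine lipschitzWith_of_nnnorm_deriv_le (fun θ => (hd θ).differentiableAt) fun θ => ?_
    rw [← NNReal.coe_le_coe, coe_nnnorm, (hd θ).deriv, Real.norm_eq_abs, NNReal.coe_one,
      abs_le]
    have he := Real.exp_pos θ
    constructor
    · rw [le_div_iff₀ (by positivity)]
      nlinarith [pow_pos he 2, pow_pos he 3, pow_pos he 4]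
    · rw [div_le_one (by positivity)]
      nlinarith [pow_pos he 2, pow_pos he 3, pow_pos he 4]
  simpa [Real.dist_eq] using hL.dist_le_mul s t

/-! ### Extension by zero, and matrix inequalities as statements about sums over the sample. -/

theorem extendZero_sub {p : ℕ} (J : Finset (Fin p)) (β β' : EuclideanSpace ℝ J) :
    extendZero J (β - β') = extendZero J β - extendZero J β' := by
  ext j
  by_cases h : j ∈ J <;> simp [extendZero, h]

theorem sum_extendZero {p : ℕ} (J : Finset (Fin p)) (β : EuclideanSpace ℝ J)
    (f : Fin p → ℝ → ℝ) (hf : ∀ j, f j 0 = 0) :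
    ∑ j, f j (extendZero J β j) = ∑ j : J, f j (β j) := by
  rw [← Finset.sum_subset (Finset.subset_univ J), ← Finset.sum_coe_sort J]
  · refine Finset.sum_congr rfl fun j _ => ?_
    simp [extendZero]
  · intro j _ hj
    simp [extendZero, hj, hf]

theorem norm_extendZero {p : ℕ} (J : Finset (Fin p)) (β : EuclideanSpace ℝ J) :
    ‖extendZero J β‖ = ‖β‖ := by
  rw [← sq_eq_sq₀ (norm_nonneg _) (norm_nonneg _), EuclideanSpace.real_norm_sq_eq,
    EuclideanSpace.real_norm_sq_eq, sum_extendZero J β (fun _ t => t ^ 2) (by simp)]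

theorem isSparse_extendZero {p q : ℕ} {J : Finset (Fin p)} (hJ : J.card ≤ q)
    (β : EuclideanSpace ℝ J) : IsSparse q (extendZero J β) := by
  refine (Finset.card_le_card fun j hj => ?_).trans hJ
  by_contra h
  simp [extendZero, h] at hj

theorem inner_extendZero {p : ℕ} (J : Finset (Fin p)) (x : EuclideanSpace ℝ (Fin p))
    (β : EuclideanSpace ℝ J) : inner ℝ x (extendZero J β) = ∑ j : J, x j * β j := by
  rw [← sum_extendZero J β (fun j t => x j * t) (by simp), PiLp.inner_apply]
  exact Finset.sum_congr rfl fun j _ => by simp [mul_comm]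

/-- The sesquilinear form of `H_J(β)` as a sum over the sample. -/
theorem dotProduct_subHessian_mulVec {n p : ℕ} (x : Fin n → EuclideanSpace ℝ (Fin p))
    (J : Finset (Fin p)) (β v w : EuclideanSpace ℝ J) :
    v.ofLp ⬝ᵥ (subHessian x J β).mulVec w.ofLp =
      ∑ i, cumulantSecond (inner ℝ (x i) (extendZero J β)) *
        (inner ℝ (x i) (extendZero J v) * inner ℝ (x i) (extendZero J w)) := by
  have h (i : Fin n) : inner ℝ (x i) (extendZero J v) * inner ℝ (x i) (extendZero J w) =
      ∑ j : J, ∑ k : J, v j * (x i j * x i k) * w k := by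
    rw [inner_extendZero, inner_extendZero, Finset.sum_mul_sum]
    exact Finset.sum_congr rfl fun j _ => Finset.sum_congr rfl fun k _ => by ring
  simp only [h, dotProduct, Matrix.mulVec, subHessian, hessian, Matrix.submatrix_apply,
    Matrix.sum_apply, Matrix.smul_apply, Matrix.vecMulVec_apply, smul_eq_mul, Finset.mul_sum,
    Finset.sum_mul]
  rw [Finset.sum_comm' (t' := Finset.univ) (s' := fun _ => Finset.univ) (by simp)]
  conv_rhs => rw [Finset.sum_comm]
  rw [Finset.sum_comm]
  refine Finset.sum_congr rfl fun j _ => ?_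
  conv_rhs => rw [Finset.sum_comm]
  refine Finset.sum_congr rfl fun k _ => ?_
  exact Finset.sum_congr rfl fun i _ => by ring

theorem isHermitian_subHessian {n p : ℕ} (x : Fin n → EuclideanSpace ℝ (Fin p))
    (J : Finset (Fin p)) (β : EuclideanSpace ℝ J) : (subHessian x J β).IsHermitian := by
  ext j k
  simp only [Matrix.conjTranspose_apply, subHessian, hessian, Matrix.submatrix_apply,
    Matrix.sum_apply, Matrix.smul_apply, Matrix.vecMulVec_apply, smul_eq_mul, star_trivial]
  exact Finset.sum_congr rfl fun i _ => by ring

theorem dotProduct_self_eq_norm_sq {ι : Type*} [Fintype ι] (v : ι → ℝ) :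
    v ⬝ᵥ v = ‖WithLp.toLp 2 v‖ ^ 2 := by
  rw [EuclideanSpace.real_norm_sq_eq]
  exact Finset.sum_congr rfl fun j _ => by simp [sq]

theorem smul_one_loewnerLE_subHessian {n p : ℕ} {x : Fin n → EuclideanSpace ℝ (Fin p)}
    {J : Finset (Fin p)} {β : EuclideanSpace ℝ J} {c : ℝ}
    (h : ∀ v : EuclideanSpace ℝ J, c * ‖v‖ ^ 2 ≤ 1 / (n : ℝ) *
      ∑ i, cumulantSecond (inner ℝ (x i) (extendZero J β)) *
        inner ℝ (x i) (extendZero J v) ^ 2) :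
    LoewnerLE (c • (1 : Matrix J J ℝ)) ((1 / (n : ℝ)) • subHessian x J β) := by
  refine Matrix.PosSemidef.of_dotProduct_mulVec_nonneg ?_ fun v => ?_
  · exact ((isHermitian_subHessian x J β).smul (IsSelfAdjoint.all _)).sub
      (Matrix.isHermitian_one.smul (IsSelfAdjoint.all _))
  · have h1 := h (WithLp.toLp 2 v)
    have h2 := dotProduct_subHessian_mulVec x J β (WithLp.toLp 2 v) (WithLp.toLp 2 v)
    simp only [← sq] at h2
    rw [← h2, ← dotProduct_self_eq_norm_sq] at h1
    simpa [Matrix.sub_mulVec, Matrix.smul_mulVec, dotProduct_sub] using h1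

theorem subHessian_loewnerLE_smul_one {n p : ℕ} {x : Fin n → EuclideanSpace ℝ (Fin p)}
    {J : Finset (Fin p)} {β : EuclideanSpace ℝ J} {c : ℝ}
    (h : ∀ v : EuclideanSpace ℝ J, 1 / (n : ℝ) *
      ∑ i, cumulantSecond (inner ℝ (x i) (extendZero J β)) *
        inner ℝ (x i) (extendZero J v) ^ 2 ≤ c * ‖v‖ ^ 2) :
    LoewnerLE ((1 / (n : ℝ)) • subHessian x J β) (c • (1 : Matrix J J ℝ)) := by
  refine Matrix.PosSemidef.of_dotProduct_mulVec_nonneg ?_ fun v => ?_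
  · exact (Matrix.isHermitian_one.smul (IsSelfAdjoint.all _)).sub
      ((isHermitian_subHessian x J β).smul (IsSelfAdjoint.all _))
  · have h1 := h (WithLp.toLp 2 v)
    have h2 := dotProduct_subHessian_mulVec x J β (WithLp.toLp 2 v) (WithLp.toLp 2 v)
    simp only [← sq] at h2
    rw [← h2, ← dotProduct_self_eq_norm_sq] at h1
    simpa [Matrix.sub_mulVec, Matrix.smul_mulVec, dotProduct_sub] using h1

/-- Testing the bilinear form with `v = A w` gives `‖A w‖² ≤ c ‖A w‖ ‖w‖`. -/
theorem spectralNorm_le {ι : Type*} [Fintype ι] [DecidableEq ι] {A : Matrix ι ι ℝ} {c : ℝ}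
    (hc : 0 ≤ c)
    (h : ∀ v w : EuclideanSpace ℝ ι, v.ofLp ⬝ᵥ A.mulVec w.ofLp ≤ c * (‖v‖ * ‖w‖)) :
    spectralNorm A ≤ c := by
  refine ContinuousLinearMap.opNorm_le_bound _ hc fun w => ?_
  set z := Matrix.toEuclideanCLM (n := ι) (𝕜 := ℝ) A w with hz
  have h1 := h z w
  have h2 : z.ofLp ⬝ᵥ A.mulVec w.ofLp = ‖z‖ ^ 2 := by
    rw [← Matrix.ofLp_toEuclideanCLM, ← hz, dotProduct_self_eq_norm_sq]
  rw [h2] at h1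
  rcases (norm_nonneg z).eq_or_lt with h0 | h0
  · rw [← h0]; positivity
  · nlinarith

/-! ### From empirical moments to the Hessian conditions. -/

/-- Trilinear Hölder bound for a sample whose third absolute moments in sparse directions are
bounded. -/
theorem sum_abs_inner_mul_le {n p q : ℕ} {x : Fin n → EuclideanSpace ℝ (Fin p)} {C : ℝ}
    (h3 : ∀ u, IsSparse q u → ∑ i, |inner ℝ (x i) u| ^ 3 ≤ C * ‖u‖ ^ 3)
    {u v w : EuclideanSpace ℝ (Fin p)} (hu : IsSparse q u) (hv : IsSparse q v)
    (hw : IsSparse q w) :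
    ∑ i, |inner ℝ (x i) u| * |inner ℝ (x i) v| * |inner ℝ (x i) w| ≤
      C * (‖u‖ * ‖v‖ * ‖w‖) := by
  rcases eq_or_ne u 0 with rfl | hu0
  · simp
  rcases eq_or_ne v 0 with rfl | hv0
  · simp
  rcases eq_or_ne w 0 with rfl | hw0
  · simp
  have hu' := norm_pos_iff.2 hu0
  have hv' := norm_pos_iff.2 hv0
  have hw' := norm_pos_iff.2 hw0
  -- After normalizing the three directions, AM-GM in each summand replaces Hölder's inequality.
  have amgm (a b c : ℝ) (ha : 0 ≤ a) (hb : 0 ≤ b) (hc : 0 ≤ c) :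
      a * b * c ≤ (a ^ 3 + b ^ 3 + c ^ 3) / 3 := by
    nlinarith [mul_nonneg (add_nonneg (add_nonneg ha hb) hc)
      (add_nonneg (add_nonneg (sq_nonneg (a - b)) (sq_nonneg (b - c))) (sq_nonneg (a - c)))]
  have norm3 (u : EuclideanSpace ℝ (Fin p)) (hu : IsSparse q u) (hu' : 0 < ‖u‖) :
      ∑ i, (|inner ℝ (x i) u| / ‖u‖) ^ 3 ≤ C := by
    simp only [div_pow]
    rw [← Finset.sum_div, div_le_iff₀ (by positivity)]
    exact h3 u hu
  have key : ∑ i, (|inner ℝ (x i) u| / ‖u‖) * (|inner ℝ (x i) v| / ‖v‖) *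
      (|inner ℝ (x i) w| / ‖w‖) ≤ C := by
    refine (Finset.sum_le_sum fun i _ => amgm _ _ _ (by positivity) (by positivity)
      (by positivity)).trans ?_
    rw [← Finset.sum_div, Finset.sum_add_distrib, Finset.sum_add_distrib]
    linarith [norm3 u hu hu', norm3 v hv hv', norm3 w hw hw']
  have e (i : Fin n) : |inner ℝ (x i) u| * |inner ℝ (x i) v| * |inner ℝ (x i) w| =
      (|inner ℝ (x i) u| / ‖u‖) * (|inner ℝ (x i) v| / ‖v‖) * (|inner ℝ (x i) w| / ‖w‖) *
        (‖u‖ * ‖v‖ * ‖w‖) := by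
    field_simp
  rw [Finset.sum_congr rfl fun i _ => e i, ← Finset.sum_mul]
  gcongr

/-- Comes from `s² ≤ 1 + s³` with `s = |xᵢᵀu| / ‖u‖`; no separate upper tail bound for squares is
needed. -/
theorem sum_inner_sq_le {n p q : ℕ} {x : Fin n → EuclideanSpace ℝ (Fin p)} {C : ℝ}
    (h3 : ∀ u, IsSparse q u → ∑ i, |inner ℝ (x i) u| ^ 3 ≤ n * C * ‖u‖ ^ 3)
    {u : EuclideanSpace ℝ (Fin p)} (hu : IsSparse q u) :
    ∑ i, inner ℝ (x i) u ^ 2 ≤ n * (1 + C) * ‖u‖ ^ 2 := by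
  rcases eq_or_ne u 0 with rfl | hu0
  · simp
  have hu' := norm_pos_iff.2 hu0
  have h : ∀ i, inner ℝ (x i) u ^ 2 ≤ ‖u‖ ^ 2 + |inner ℝ (x i) u| ^ 3 / ‖u‖ := fun i => by
    rw [← sq_abs, ← sub_le_iff_le_add', le_div_iff₀ hu']
    set a := |inner ℝ (x i) u|
    have ha : 0 ≤ a := abs_nonneg _
    nlinarith [mul_nonneg (add_nonneg ha hu'.le) (sq_nonneg (a - ‖u‖)), pow_pos hu' 3,
      mul_nonneg ha (sq_nonneg (a - ‖u‖)), mul_nonneg (sq_nonneg a) hu'.le,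
      mul_nonneg ha (sq_nonneg ‖u‖), pow_nonneg ha 3]
  calc ∑ i, inner ℝ (x i) u ^ 2 ≤ ∑ i, (‖u‖ ^ 2 + |inner ℝ (x i) u| ^ 3 / ‖u‖) :=
        Finset.sum_le_sum fun i _ => h i
    _ = n * ‖u‖ ^ 2 + (∑ i, |inner ℝ (x i) u| ^ 3) / ‖u‖ := by
        rw [Finset.sum_add_distrib, ← Finset.sum_div]; simp
    _ ≤ n * ‖u‖ ^ 2 + (n * C * ‖u‖ ^ 3) / ‖u‖ := by gcongr; exact h3 u hu
    _ = n * (1 + C) * ‖u‖ ^ 2 := by field_simp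

/-- Bounds on the empirical second and third moments in sparse directions imply the curvature and
Lipschitz bounds for the Hessian. -/
theorem hessianConditions_of_moments {n p q : ℕ} (hn : 0 < n)
    {x : Fin n → EuclideanSpace ℝ (Fin p)} {a C : ℝ} (ha : 0 < a) (hC : 0 < C)
    (h3 : ∀ u, IsSparse q u → ∑ i, |inner ℝ (x i) u| ^ 3 ≤ n * C * ‖u‖ ^ 3)
    (h2 : ∀ u, IsSparse q u → n * a * ‖u‖ ^ 2 ≤ ∑ i, inner ℝ (x i) u ^ 2) :
    HessianConditions x q (fun r => cumulantSecond (2 * C / a * r) * (a / 2))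
      (fun r => 1 + C + r) C := by
  intro J hJ β β'
  have hn' : (0 : ℝ) < n := by exact_mod_cast hn
  have sp := fun v : EuclideanSpace ℝ J => isSparse_extendZero hJ v
  refine ⟨smul_one_loewnerLE_subHessian fun v => ?_,
    subHessian_loewnerLE_smul_one fun v => ?_, ?_⟩
  · set K := 2 * C / a with hK
    have hK0 : 0 < K := by positivity
    set r := ‖β‖ with hr
    have hr0 : 0 ≤ r := norm_nonneg _
    -- Linear truncation at `|t| = K r`: below it monotonicity of `b''` suffices, above it the left
    -- side is nonpositive.
    have hpt (i : Fin n) : cumulantSecond (K * r) * (inner ℝ (x i) (extendZero J v) ^ 2 -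
        |inner ℝ (x i) (extendZero J β)| * inner ℝ (x i) (extendZero J v) ^ 2 / (K * r)) ≤
        cumulantSecond (inner ℝ (x i) (extendZero J β)) *
          inner ℝ (x i) (extendZero J v) ^ 2 := by
      set t := inner ℝ (x i) (extendZero J β)
      set y := inner ℝ (x i) (extendZero J v) ^ 2
      have hy : 0 ≤ y := sq_nonneg _
      have hb := (cumulantSecond_pos (K * r)).le
      rcases le_or_gt |t| (K * r) with ht | ht
      · have h1 : cumulantSecond (K * r) ≤ cumulantSecond t := by
          rw [← cumulantSecond_abs t]
          exact strictAntiOn_cumulantSecond.antitoneOn (abs_nonneg t)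
            ((abs_nonneg t).trans ht) ht
        have h2 : 0 ≤ |t| * y / (K * r) := by positivity
        nlinarith [mul_nonneg (sub_nonneg.2 h1) hy, mul_nonneg hb h2]
      · have hr1 : 0 < r := by
          rcases hr0.eq_or_lt with h0 | h0
          · have : extendZero J β = 0 := by
              rw [← norm_eq_zero, norm_extendZero, ← hr, ← h0]
            simp [t, this, ← h0] at ht
          · exact h0
        have h2 : y ≤ |t| * y / (K * r) := by
          rw [le_div_iff₀ (by positivity)]
          nlinarith
        have h3 := mul_nonneg (cumulantSecond_pos t).le hy
        nlinarith [mul_nonneg hb (sub_nonneg.2 h2)]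
    have hsum := Finset.sum_le_sum fun i (_ : i ∈ Finset.univ) => hpt i
    rw [← Finset.mul_sum, Finset.sum_sub_distrib, ← Finset.sum_div] at hsum
    have htri := sum_abs_inner_mul_le h3 (sp β) (sp v) (sp v)
    simp only [mul_assoc, ← sq, sq_abs, norm_extendZero] at htri
    have hl := h2 _ (sp v)
    rw [norm_extendZero] at hl
    -- `K = 2C/a` makes the trilinear term `n C / K = n a / 2`, half of the second moment bound. For
    -- `r = 0` the quotient is `0` by convention.
    have hdiv : (∑ i, |inner ℝ (x i) (extendZero J β)| *
        inner ℝ (x i) (extendZero J v) ^ 2) / (K * r) ≤ n * (a / 2) * ‖v‖ ^ 2 := by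
      rcases hr0.eq_or_lt with h0 | h0
      · rw [← h0]; simp only [mul_zero, div_zero]; positivity
      · rw [div_le_iff₀ (by positivity)]
        refine htri.trans (le_of_eq ?_)
        rw [← hr, hK]
        field_simp
    rw [one_div, inv_mul_eq_div, le_div_iff₀ hn']
    refine le_trans ?_ hsum
    have hb := (cumulantSecond_pos (K * r)).le
    nlinarith [mul_le_mul_of_nonneg_left (sub_le_sub hl hdiv) hb]
  · have h := sum_inner_sq_le h3 (sp v)
    rw [norm_extendZero] at h
    rw [one_div, inv_mul_eq_div, div_le_iff₀ hn']
    refine (Finset.sum_le_sum fun i _ => mul_le_of_le_one_left (sq_nonneg _)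
      (cumulantSecond_le_one _)).trans (h.trans ?_)
    -- The constant `1 + C` already suffices; the summand `r` only makes `cUpper` strictly
    -- increasing.
    nlinarith [mul_nonneg (mul_nonneg (norm_nonneg β) (sq_nonneg ‖v‖)) hn'.le]
  · rw [one_div, inv_mul_eq_div, div_le_iff₀ hn']
    refine spectralNorm_le (by positivity) fun v w => ?_
    rw [Matrix.sub_mulVec, dotProduct_sub, dotProduct_subHessian_mulVec,
      dotProduct_subHessian_mulVec, ← Finset.sum_sub_distrib]
    have htri := sum_abs_inner_mul_le h3 (sp (β - β')) (sp v) (sp w)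
    rw [norm_extendZero, norm_extendZero, norm_extendZero] at htri
    calc _ ≤ ∑ i, |inner ℝ (x i) (extendZero J (β - β'))| * |inner ℝ (x i) (extendZero J v)| *
          |inner ℝ (x i) (extendZero J w)| := by
          refine Finset.sum_le_sum fun i _ => ?_
          rw [← sub_mul, extendZero_sub, inner_sub_right]
          refine (le_abs_self _).trans ?_
          rw [abs_mul, abs_mul, mul_assoc]
          exact mul_le_mul_of_nonneg_right (abs_cumulantSecond_sub_le _ _) (by positivity)
      _ ≤ _ := htri
      _ = _ := by ring

/-! ### Measurability of the event. -/

theorem continuous_subHessian {n p : ℕ} (J : Finset (Fin p)) (β : EuclideanSpace ℝ J) :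
    Continuous fun x : Fin n → EuclideanSpace ℝ (Fin p) => subHessian x J β := by
  refine continuous_matrix fun j k => ?_
  simp only [subHessian, hessian, Matrix.submatrix_apply, Matrix.sum_apply, Matrix.smul_apply,
    Matrix.vecMulVec_apply, smul_eq_mul]
  refine continuous_finsetSum _ fun i _ => ?_
  exact (continuous_cumulantSecond.comp (by fun_prop)).mul (by fun_prop)

theorem isClosed_posSemidef {ι : Type*} [Fintype ι] :
    IsClosed {A : Matrix ι ι ℝ | A.PosSemidef} := by
  simp only [Matrix.posSemidef_iff_dotProduct_mulVec, Matrix.IsHermitian, Set.ofPred_and,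
    Set.ofPred_forall]
  refine (isClosed_eq (by fun_prop) continuous_id).inter (isClosed_iInter fun v =>
    isClosed_le continuous_const ?_)
  fun_prop

theorem continuous_spectralNorm {ι : Type*} [Fintype ι] [DecidableEq ι] :
    Continuous (spectralNorm : Matrix ι ι ℝ → ℝ) :=
  continuous_norm.comp ((Matrix.toEuclideanCLM (n := ι) (𝕜 := ℝ)).toAlgEquiv.toLinearMap
    |>.continuous_of_finiteDimensional)

/-- Each condition is closed in the sample for fixed `β, β'`, so the uncountable intersection is
still closed, hence Borel. No regularity of `cLower` or `cUpper` is involved. -/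
theorem isClosed_hessianConditions (n p q : ℕ) (cLower cUpper : ℝ → ℝ) (cChange : ℝ) :
    IsClosed {x : Fin n → EuclideanSpace ℝ (Fin p) |
      HessianConditions x q cLower cUpper cChange} := by
  simp only [HessianConditions, LoewnerLE, Set.ofPred_forall, Set.ofPred_and]
  refine isClosed_iInter fun J => isClosed_iInter fun _ => isClosed_iInter fun β =>
    isClosed_iInter fun β' => ?_
  have h1 := continuous_subHessian (n := n) J β
  have h2 := continuous_subHessian (n := n) J β'
  refine (isClosed_posSemidef.preimage (by fun_prop)).inter
    ((isClosed_posSemidef.preimage (by fun_prop)).inter (isClosed_le ?_ continuous_const))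
  exact continuous_const.mul (continuous_spectralNorm.comp (h1.sub h2))

/-! ### A finite net of sparse vectors. -/

theorem IsSparse.smul {p q : ℕ} {u : EuclideanSpace ℝ (Fin p)} (hu : IsSparse q u) (c : ℝ) :
    IsSparse q (c • u) := by
  refine (Finset.card_le_card fun j hj => ?_).trans hu
  simp only [Finset.mem_filter, Finset.mem_univ, true_and] at hj ⊢
  exact right_ne_zero_of_mul (a := c) hj

/-- The sum of `q` multiples of coordinate vectors, with coefficients `c / (K q) - 1` for
integers `0 ≤ c ≤ 2 K q`. -/
noncomputable def netVec {p : ℕ} (q K : ℕ) (idx : Fin q → Fin p × Fin (2 * (K * q) + 1)) :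
    EuclideanSpace ℝ (Fin p) :=
  WithLp.toLp 2 fun j => ∑ k,
    if (idx k).1 = j then (((idx k).2 : ℕ) : ℝ) / ((K : ℝ) * q) - 1 else 0

theorem isSparse_netVec {p : ℕ} (q K : ℕ) (idx : Fin q → Fin p × Fin (2 * (K * q) + 1)) :
    IsSparse q (netVec q K idx) := by
  have h : (Finset.univ.filter fun j => netVec q K idx j ≠ 0) ⊆
      Finset.univ.image fun k => (idx k).1 := by
    intro j hj
    simp only [Finset.mem_filter, Finset.mem_univ, true_and] at hj
    by_contra h
    apply hj
    change ∑ k, (if (idx k).1 = j then _ else (0 : ℝ)) = 0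
    refine Finset.sum_eq_zero fun k _ => if_neg fun hk => h ?_
    exact Finset.mem_image.2 ⟨k, Finset.mem_univ k, hk⟩
  exact (Finset.card_le_card h).trans (Finset.card_image_le.trans (by simp))

/-- Coordinatewise rounding down of a sparse vector of the unit ball gives a vector of the net. -/
theorem exists_netVec {p q K : ℕ} (hp : 0 < p) (hq : 1 ≤ q) (hK : 1 ≤ K)
    {u : EuclideanSpace ℝ (Fin p)} (hu : IsSparse q u) (hu1 : ‖u‖ ≤ 1) :
    ∃ idx : Fin q → Fin p × Fin (2 * (K * q) + 1),
      IsSparse q (u - netVec q K idx) ∧ ‖u - netVec q K idx‖ ≤ 1 / K := by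
  set m : ℝ := (K : ℝ) * q with hm
  have hq0 : (1 : ℝ) ≤ q := by exact_mod_cast hq
  have hK0 : (1 : ℝ) ≤ K := by exact_mod_cast hK
  have hm0 : 0 < m := by positivity
  have hcoord (j : Fin p) : |u j| ≤ 1 := (PiLp.norm_apply_le u j).trans hu1
  have hcode (j : Fin p) : ∃ c : Fin (2 * (K * q) + 1),
      (((c : ℕ) : ℝ) / m - 1) = (⌊u j * m⌋ : ℝ) / m := by
    obtain ⟨h1, h2⟩ := abs_le.1 (hcoord j)
    have h3 : -((K * q : ℕ) : ℤ) ≤ ⌊u j * m⌋ := by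
      rw [Int.le_floor]; push_cast; rw [← hm]; nlinarith
    have h4 : ⌊u j * m⌋ ≤ ((K * q : ℕ) : ℤ) := by
      have : (⌊u j * m⌋ : ℝ) ≤ ((K * q : ℕ) : ℤ) := by
        refine (Int.floor_le _).trans ?_
        push_cast; rw [← hm]; nlinarith
      exact_mod_cast this
    refine ⟨⟨(⌊u j * m⌋ + ((K * q : ℕ) : ℤ)).toNat, by omega⟩, ?_⟩
    have h5 : (((⌊u j * m⌋ + ((K * q : ℕ) : ℤ)).toNat : ℕ) : ℝ) = ⌊u j * m⌋ + m := by
      have h6 : (((⌊u j * m⌋ + ((K * q : ℕ) : ℤ)).toNat : ℕ) : ℤ) =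
        ⌊u j * m⌋ + ((K * q : ℕ) : ℤ) := Int.toNat_of_nonneg (by omega)
      have h7 := congrArg (Int.cast : ℤ → ℝ) h6
      rw [Int.cast_natCast] at h7
      rw [h7, hm]
      push_cast
      rfl
    simp only [h5]
    field_simp
    ring
  choose code hcode using hcode
  set T := Finset.univ.filter fun j => u j ≠ 0 with hT
  obtain ⟨e⟩ : Nonempty (T ↪ Fin q) := Function.Embedding.nonempty_of_card_le (by
    rw [Fintype.card_coe, Fintype.card_fin]; exact hu)
  -- Slots not used by the support of `u` carry the code `K q`, whose coefficient is `0`.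
  let idx : Fin q → Fin p × Fin (2 * (K * q) + 1) :=
    Function.extend e (fun t => (t.1, code t.1)) fun _ => (⟨0, hp⟩, ⟨K * q, by omega⟩)
  have hval (j : Fin p) : netVec q K idx j = (⌊u j * m⌋ : ℝ) / m := by
    have h1 : netVec q K idx j = ∑ t : T, if t.1 = j then (⌊u t.1 * m⌋ : ℝ) / m else 0 := by
      refine (Fintype.sum_of_injective e e.injective _ _ (fun k hk => ?_) fun t => ?_).symm
      · have : idx k = (⟨0, hp⟩, ⟨K * q, by omega⟩) :=
          Function.extend_apply' _ _ _ (by simpa using hk)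
        rw [this]
        push_cast
        rw [← hm, div_self hm0.ne', sub_self, ite_self]
      · have : idx (e t) = (t.1, code t.1) := e.injective.extend_apply _ _ _
        rw [this, ← hcode]
    rw [h1, Finset.sum_coe_sort T fun t => if t = j then (⌊u t * m⌋ : ℝ) / m else 0,
      Finset.sum_ite_eq' T j]
    split_ifs with hj
    · rfl
    · have : u j = 0 := by simpa [hT] using hj
      simp [this]
  -- Since `⌊0⌋ = 0`, rounding does not enlarge the support, which keeps the difference `q`-sparse.
  have hzero (j : Fin p) (hj : u j = 0) : (u - netVec q K idx) j = 0 := by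
    rw [PiLp.sub_apply, hval, hj]; simp
  refine ⟨idx, (Finset.card_le_card fun j hj => ?_).trans hu, ?_⟩
  · simp only [Finset.mem_filter, Finset.mem_univ, true_and] at hj ⊢
    exact fun h => hj (hzero j h)
  · refine le_of_sq_le_sq ?_ (by positivity)
    rw [EuclideanSpace.real_norm_sq_eq, ← Finset.sum_subset (Finset.subset_univ T)
      fun j _ hj => by rw [hzero j (by simpa [hT] using hj)]; simp]
    have hb (j : Fin p) : (u - netVec q K idx) j ^ 2 ≤ (1 / m) ^ 2 := by
      rw [PiLp.sub_apply, hval]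
      have h1 := Int.floor_le (u j * m)
      have h2 := (Int.lt_floor_add_one (u j * m)).le
      have h3 : u j - ⌊u j * m⌋ / m = (u j * m - ⌊u j * m⌋) / m := by field_simp
      rw [h3]
      gcongr
      linarith
    calc _ ≤ ∑ j ∈ T, (1 / m) ^ 2 := Finset.sum_le_sum fun j _ => hb j
      _ = (T.card : ℝ) * (1 / m) ^ 2 := by simp
      _ ≤ q * (1 / m) ^ 2 := by
          gcongr
          exact hu
      _ ≤ (1 / (K : ℝ)) ^ 2 := by
          rw [hm]
          field_simp
          nlinarith

/-! ### From the net to all sparse vectors. -/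

theorem abs_add_cube_le (a b : ℝ) : |a + b| ^ 3 ≤ 4 * |a| ^ 3 + 4 * |b| ^ 3 := by
  have h : (|a| + |b|) ^ 3 ≤ 4 * |a| ^ 3 + 4 * |b| ^ 3 := by
    nlinarith [mul_nonneg (add_nonneg (abs_nonneg a) (abs_nonneg b)) (sq_nonneg (|a| - |b|))]
  exact (pow_le_pow_left₀ (abs_nonneg _) (abs_add_le a b) 3).trans h

/-- A bound on the third moments along the unit sphere extends by homogeneity. -/
theorem sum_abs_inner_cube_le_of_unit {n p q : ℕ} {x : Fin n → EuclideanSpace ℝ (Fin p)} {B : ℝ}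
    (h : ∀ u, IsSparse q u → ‖u‖ = 1 → ∑ i, |inner ℝ (x i) u| ^ 3 ≤ B)
    {u : EuclideanSpace ℝ (Fin p)} (hu : IsSparse q u) :
    ∑ i, |inner ℝ (x i) u| ^ 3 ≤ B * ‖u‖ ^ 3 := by
  rcases eq_or_ne u 0 with rfl | hu0
  · simp
  have h1 := h _ (hu.smul ‖u‖⁻¹) (by simp [norm_smul, hu0])
  simp only [inner_smul_right, abs_mul, mul_pow, abs_inv, abs_norm] at h1
  rw [← Finset.mul_sum] at h1
  rwa [← div_le_iff₀ (by positivity), div_eq_inv_mul, ← inv_pow]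

theorem le_sum_inner_sq_of_unit {n p q : ℕ} {x : Fin n → EuclideanSpace ℝ (Fin p)} {B : ℝ}
    (h : ∀ u, IsSparse q u → ‖u‖ = 1 → B ≤ ∑ i, inner ℝ (x i) u ^ 2)
    {u : EuclideanSpace ℝ (Fin p)} (hu : IsSparse q u) :
    B * ‖u‖ ^ 2 ≤ ∑ i, inner ℝ (x i) u ^ 2 := by
  rcases eq_or_ne u 0 with rfl | hu0
  · simp
  have h1 := h _ (hu.smul ‖u‖⁻¹) (by simp [norm_smul, hu0])
  simp only [inner_smul_right, mul_pow] at h1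
  rw [← Finset.mul_sum] at h1
  rwa [← le_div_iff₀ (by positivity), div_eq_inv_mul, ← inv_pow]

theorem norm_le_of_norm_sub_le {p K : ℕ} (hK : 2 ≤ K) {u v : EuclideanSpace ℝ (Fin p)}
    (hu : ‖u‖ = 1) (h : ‖u - v‖ ≤ 1 / K) :
    ‖u - v‖ ≤ 1 / 2 ∧ 1 / 2 ≤ ‖v‖ ∧ ‖v‖ ≤ 2 := by
  have hK' : (2 : ℝ) ≤ K := by exact_mod_cast hK
  have h1 : ‖u - v‖ ≤ 1 / 2 := h.trans (by gcongr)
  have h2 := norm_sub_norm_le u v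
  have h3 := norm_sub_norm_le v u
  rw [norm_sub_rev] at h3
  exact ⟨h1, by linarith, by linarith⟩

/-- A bound on the third moments over the net extends to all sparse vectors. -/
theorem third_moment_of_net {n p q K : ℕ} (hp : 0 < p) (hq : 1 ≤ q) (hK : 2 ≤ K)
    {x : Fin n → EuclideanSpace ℝ (Fin p)} {s : ℝ} (hs : 0 ≤ s)
    (h : ∀ idx, ∑ i, |inner ℝ (x i) (netVec q K idx)| ^ 3 ≤ n * s * ‖netVec q K idx‖ ^ 3) :
    ∀ u, IsSparse q u → ∑ i, |inner ℝ (x i) u| ^ 3 ≤ n * (64 * s) * ‖u‖ ^ 3 := by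
  let Q : Set ℝ := {t | ∃ u, IsSparse q u ∧ ‖u‖ = 1 ∧ t = ∑ i, |inner ℝ (x i) u| ^ 3}
  -- Only finiteness matters: `S ≤ 32 n s + S / 2` can then be solved for `S = sSup Q`.
  have hQ : BddAbove Q := by
    refine ⟨∑ i, ‖x i‖ ^ 3, ?_⟩
    rintro t ⟨u, _, hu, rfl⟩
    gcongr with i
    simpa [hu] using abs_real_inner_le_norm (x i) u
  have hS0 : 0 ≤ sSup Q := Real.sSup_nonneg (by
    rintro t ⟨u, _, _, rfl⟩; positivity)
  have hle (u) (hu : IsSparse q u) : ∑ i, |inner ℝ (x i) u| ^ 3 ≤ sSup Q * ‖u‖ ^ 3 :=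
    sum_abs_inner_cube_le_of_unit (fun u hu hu1 => le_csSup hQ ⟨u, hu, hu1, rfl⟩) hu
  -- Here `32 = 4 · 2³` from `‖v‖ ≤ 2`, and `1/2 = 4 · (1/2)³` from `‖u - v‖ ≤ 1/2`.
  have hstep : ∀ t ∈ Q, t ≤ n * (32 * s) + sSup Q / 2 := by
    rintro t ⟨u, hu, hu1, rfl⟩
    obtain ⟨idx, h1, h2⟩ := exists_netVec hp hq (by omega : 1 ≤ K) hu hu1.le
    obtain ⟨h3, _, h5⟩ := norm_le_of_norm_sub_le hK hu1 h2
    set v := netVec q K idx with hv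
    have hA : ∑ i, |inner ℝ (x i) v| ^ 3 ≤ n * s * 2 ^ 3 := (h idx).trans (by gcongr)
    have hB : ∑ i, |inner ℝ (x i) (u - v)| ^ 3 ≤ sSup Q * (1 / 2) ^ 3 :=
      (hle _ h1).trans (by gcongr)
    have hC : ∑ i, |inner ℝ (x i) u| ^ 3 ≤
        ∑ i, (4 * |inner ℝ (x i) v| ^ 3 + 4 * |inner ℝ (x i) (u - v)| ^ 3) := by
      refine Finset.sum_le_sum fun i _ => ?_
      have := abs_add_cube_le (inner ℝ (x i) v) (inner ℝ (x i) (u - v))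
      rwa [← inner_add_right, add_sub_cancel] at this
    rw [Finset.sum_add_distrib, ← Finset.mul_sum, ← Finset.mul_sum] at hC
    linarith
  have hS : sSup Q ≤ n * (64 * s) := by
    have := Real.sSup_le hstep (by positivity)
    linarith
  exact fun u hu => (hle u hu).trans (by gcongr)

/-- A lower bound on the second moments over the net extends to all sparse vectors. -/
theorem second_moment_of_net {n p q K : ℕ} (hp : 0 < p) (hq : 1 ≤ q) (hK : 2 ≤ K)
    {x : Fin n → EuclideanSpace ℝ (Fin p)} {a C : ℝ} (ha : 0 < a) (hC : 0 ≤ C)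
    (hKa : 16 * (1 + C) ≤ a * K ^ 2)
    (h3 : ∀ u, IsSparse q u → ∑ i, |inner ℝ (x i) u| ^ 3 ≤ n * C * ‖u‖ ^ 3)
    (h : ∀ idx, n * a * ‖netVec q K idx‖ ^ 2 ≤ ∑ i, inner ℝ (x i) (netVec q K idx) ^ 2) :
    ∀ u, IsSparse q u → n * (a / 16) * ‖u‖ ^ 2 ≤ ∑ i, inner ℝ (x i) u ^ 2 := by
  intro u hu
  refine le_sum_inner_sq_of_unit (fun u hu hu1 => ?_) hu
  obtain ⟨idx, h1, h2⟩ := exists_netVec hp hq (by omega : 1 ≤ K) hu hu1.le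
  obtain ⟨_, h4, _⟩ := norm_le_of_norm_sub_le hK hu1 h2
  set v := netVec q K idx with hv
  have hK0 : (0 : ℝ) < K := by exact_mod_cast (by omega : 0 < K)
  have hA : n * a * (1 / 2) ^ 2 ≤ ∑ i, inner ℝ (x i) v ^ 2 := le_trans (by gcongr) (h idx)
  have hB : ∑ i, inner ℝ (x i) (u - v) ^ 2 ≤ n * (a / 16) := by
    refine (sum_inner_sq_le h3 h1).trans ?_
    calc n * (1 + C) * ‖u - v‖ ^ 2 ≤ n * (1 + C) * (1 / K) ^ 2 := by gcongr
      _ = n * ((1 + C) / K ^ 2) := by ring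
      _ ≤ n * (a / 16) := by
          refine mul_le_mul_of_nonneg_left ?_ (Nat.cast_nonneg n)
          rw [div_le_iff₀ (by positivity)]
          linarith
  -- Combined with `hA` and `hB`, this gives `n a / 4 ≤ 2 ∑ (xᵢᵀu)² + n a / 8`.
  have hD : ∑ i, inner ℝ (x i) v ^ 2 ≤
      ∑ i, (2 * inner ℝ (x i) u ^ 2 + 2 * inner ℝ (x i) (u - v) ^ 2) := by
    refine Finset.sum_le_sum fun i _ => ?_
    rw [inner_sub_right]
    nlinarith [sq_nonneg (2 * inner ℝ (x i) u - inner ℝ (x i) v)]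
  rw [Finset.sum_add_distrib, ← Finset.mul_sum, ← Finset.mul_sum] at hD
  linarith

/-! ### Tail bounds in a single direction. -/

/-- A vector with entries bounded by `a₃` has inner product at most `a₃ √q` with a `q`-sparse unit
vector. -/
theorem abs_inner_le_of_isSparse {p q : ℕ} {x u : EuclideanSpace ℝ (Fin p)} {a₃ : ℝ}
    (ha₃ : 0 ≤ a₃) (hx : ∀ j, |x j| ≤ a₃) (hu : IsSparse q u) (hu1 : ‖u‖ = 1) :
    |inner ℝ x u| ≤ a₃ * √q := by
  set T := Finset.univ.filter fun j => u j ≠ 0 with hT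
  have h1 : inner ℝ x u = ∑ j ∈ T, x j * u j := by
    rw [PiLp.inner_apply, ← Finset.sum_subset (Finset.subset_univ T)]
    · exact Finset.sum_congr rfl fun j _ => by simp [mul_comm]
    · intro j _ hj
      have : u j = 0 := by simpa [hT] using hj
      simp [this]
  have h2 := Finset.sum_mul_sq_le_sq_mul_sq T x.ofLp u.ofLp
  have h3 : ∑ j ∈ T, u j ^ 2 ≤ 1 := by
    have := EuclideanSpace.real_norm_sq_eq u
    rw [hu1, one_pow] at this
    rw [this]
    exact Finset.sum_le_sum_of_subset_of_nonneg (Finset.subset_univ T)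
      fun _ _ _ => sq_nonneg _
  have h4 : ∑ j ∈ T, x j ^ 2 ≤ q * a₃ ^ 2 := by
    calc ∑ j ∈ T, x j ^ 2 ≤ ∑ j ∈ T, a₃ ^ 2 := Finset.sum_le_sum fun j _ => by
          rw [← sq_abs]; exact pow_le_pow_left₀ (abs_nonneg _) (hx j) 2
      _ = (T.card : ℝ) * a₃ ^ 2 := by simp
      _ ≤ q * a₃ ^ 2 := by
          gcongr
          exact hu
  refine abs_le_of_sq_le_sq ?_ (by positivity)
  rw [h1, mul_pow, Real.sq_sqrt (Nat.cast_nonneg q)]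
  refine h2.trans ?_
  nlinarith [Finset.sum_nonneg fun j (_ : j ∈ T) => sq_nonneg (x j)]

theorem ae_abs_inner_le {Ω : Type*} [MeasurableSpace Ω] {μ : Measure Ω} {p q : ℕ} {a₁ a₂ a₃ : ℝ}
    {Z : Ω → EuclideanSpace ℝ (Fin p)} (ha₃ : 0 < a₃)
    (hZ : CovariateAssumptions μ Z q a₁ a₂ a₃) {u : EuclideanSpace ℝ (Fin p)}
    (hu : IsSparse q u) (hu1 : ‖u‖ = 1) : ∀ᵐ ω ∂μ, |inner ℝ (Z ω) u| ≤ a₃ * √q := by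
  filter_upwards [ae_all_iff.2 hZ.bounded] with ω hω
  exact abs_inner_le_of_isSparse ha₃.le hω hu hu1

section Tails

variable {Ω : Type*} [MeasurableSpace Ω] {μ : Measure Ω} [IsProbabilityMeasure μ]

theorem integrable_exp_mul_sum_of_mem_Icc {n : ℕ} {Y : Fin n → Ω → ℝ}
    (hm : ∀ i, Measurable (Y i)) (hindep : iIndepFun Y μ)
    (hid : ∀ i j, IdentDistrib (Y i) (Y j) μ μ) (i₀ : Fin n) {M : ℝ}
    (hY : ∀ᵐ ω ∂μ, Y i₀ ω ∈ Set.Icc 0 M) (t : ℝ) :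
    Integrable (fun ω => Real.exp (t * (∑ i, Y i) ω)) μ := by
  refine hindep.integrable_exp_mul_sum hm fun i _ => ?_
  exact integrable_exp_mul_of_mem_Icc (hm i).aemeasurable
    ((hid i₀ i).ae_snd measurableSet_Icc hY)

/-- A Chernoff bound for sums of nonnegative bounded i.i.d. random variables. -/
theorem measureReal_three_mul_le_sum {n : ℕ} {Y : Fin n → Ω → ℝ}
    (hm : ∀ i, Measurable (Y i)) (hindep : iIndepFun Y μ)
    (hid : ∀ i j, IdentDistrib (Y i) (Y j) μ μ) (i₀ : Fin n) {M b : ℝ} (hM : 0 < M)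
    (hY : ∀ᵐ ω ∂μ, Y i₀ ω ∈ Set.Icc 0 M) (hb : ∫ ω, Y i₀ ω ∂μ ≤ b) :
    μ.real {ω | n * (3 * b) ≤ ∑ i, Y i ω} ≤ Real.exp (-(n * (b / M))) := by
  have hint : Integrable (Y i₀) μ := Integrable.of_mem_Icc 0 M (hm i₀).aemeasurable hY
  have hmgf : mgf (Y i₀) μ M⁻¹ ≤ Real.exp (2 * (b / M)) := by
    -- The parameter `1/M` keeps the exponent in `[0, 1]`, where `e^x ≤ 1 + x + x² ≤ 1 + 2x`.
    have h1 : mgf (Y i₀) μ M⁻¹ ≤ ∫ ω, (1 + 2 * M⁻¹ * Y i₀ ω) ∂μ := by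
      refine integral_mono_ae (integrable_exp_mul_of_mem_Icc (hm i₀).aemeasurable hY)
        ((integrable_const _).add (hint.const_mul _)) ?_
      filter_upwards [hY] with ω hω
      have h0 : 0 ≤ M⁻¹ * Y i₀ ω := mul_nonneg (by positivity) hω.1
      have h1 : M⁻¹ * Y i₀ ω ≤ 1 := by
        rw [inv_mul_le_iff₀ hM, mul_one]; exact hω.2
      have := (abs_le.1 (Real.abs_exp_sub_one_sub_id_le (abs_le.2 ⟨by linarith, h1⟩))).2
      nlinarith
    rw [integral_add (integrable_const _) (hint.const_mul _), integral_const_mul] at h1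
    simp only [integral_const, probReal_univ, smul_eq_mul, mul_one] at h1
    have h2 : 2 * M⁻¹ * ∫ ω, Y i₀ ω ∂μ ≤ 2 * (b / M) := by
      rw [div_eq_inv_mul, ← mul_assoc]; gcongr
    linarith [Real.add_one_le_exp (2 * (b / M))]
  have h := measure_ge_le_exp_mul_mgf (μ := μ) (X := ∑ i, Y i) (t := M⁻¹) (n * (3 * b))
    (by positivity) (integrable_exp_mul_sum_of_mem_Icc hm hindep hid i₀ hY _)
  rw [mgf_sum_of_identDistrib hm hindep (fun i _ j _ => hid i j) (Finset.mem_univ i₀)] at h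
  simp only [Finset.sum_apply, Finset.card_univ, Fintype.card_fin] at h
  refine h.trans ?_
  calc _ ≤ Real.exp (-M⁻¹ * (n * (3 * b))) * Real.exp (2 * (b / M)) ^ n := by
        gcongr; exact mgf_nonneg
    _ = Real.exp (-(n * (b / M))) := by
        rw [← Real.exp_nat_mul, ← Real.exp_add]
        congr 1
        field_simp
        ring

theorem exp_neg_le_one_sub_add_sq {y : ℝ} (hy : 0 ≤ y) : Real.exp (-y) ≤ 1 - y + y ^ 2 := by
  rcases le_total y 1 with h | h
  · have := (abs_le.1 (Real.abs_exp_sub_one_sub_id_le (x := -y)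
      (abs_le.2 ⟨by linarith, by linarith⟩))).2
    nlinarith
  · have : Real.exp (-y) ≤ 1 := Real.exp_le_one_iff.2 (by linarith)
    nlinarith

/-- A lower tail bound for sums of nonnegative i.i.d. random variables with bounded second
moment. -/
theorem measureReal_sum_le_half {n : ℕ} {Y : Fin n → Ω → ℝ}
    (hm : ∀ i, Measurable (Y i)) (hindep : iIndepFun Y μ)
    (hid : ∀ i j, IdentDistrib (Y i) (Y j) μ μ) (i₀ : Fin n) {M a V : ℝ}
    (ha : 0 < a) (hV : 0 < V) (hY : ∀ᵐ ω ∂μ, Y i₀ ω ∈ Set.Icc 0 M)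
    (haY : a ≤ ∫ ω, Y i₀ ω ∂μ) (hVY : ∫ ω, Y i₀ ω ^ 2 ∂μ ≤ V) :
    μ.real {ω | ∑ i, Y i ω ≤ n * (a / 2)} ≤ Real.exp (-(n * (a ^ 2 / (16 * V)))) := by
  have hint : Integrable (Y i₀) μ := Integrable.of_mem_Icc 0 M (hm i₀).aemeasurable hY
  have hint2 : Integrable (fun ω => Y i₀ ω ^ 2) μ := by
    refine Integrable.of_mem_Icc 0 (M ^ 2) ((hm i₀).pow_const 2).aemeasurable ?_
    filter_upwards [hY] with ω hω
    exact ⟨sq_nonneg _, pow_le_pow_left₀ hω.1 hω.2 2⟩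
  -- This minimizes the resulting exponent `-l a / 2 + l² V`.
  set l := a / (4 * V) with hl
  have hl0 : 0 < l := by positivity
  have hmgf : mgf (Y i₀) μ (-l) ≤ Real.exp (-(3 / 4 * l * a)) := by
    have h1 : mgf (Y i₀) μ (-l) ≤ ∫ ω, (1 - l * Y i₀ ω + l ^ 2 * Y i₀ ω ^ 2) ∂μ := by
      refine integral_mono_ae (integrable_exp_mul_of_mem_Icc (hm i₀).aemeasurable hY)
        (((integrable_const _).sub (hint.const_mul _)).add (hint2.const_mul _)) ?_
      filter_upwards [hY] with ω hω
      have := exp_neg_le_one_sub_add_sq (mul_nonneg hl0.le hω.1)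
      rwa [mul_pow, ← neg_mul] at this
    have hint1 : Integrable (fun ω => 1 - l * Y i₀ ω) μ :=
      (integrable_const _).sub (hint.const_mul _)
    rw [integral_add hint1 (hint2.const_mul _), integral_sub (integrable_const _)
      (hint.const_mul _), integral_const_mul, integral_const_mul] at h1
    simp only [integral_const, probReal_univ, smul_eq_mul, mul_one] at h1
    have h2 : l * a ≤ l * ∫ ω, Y i₀ ω ∂μ := by gcongr
    have h3 : l ^ 2 * ∫ ω, Y i₀ ω ^ 2 ∂μ ≤ l ^ 2 * V := by gcongr
    have h4 : l ^ 2 * V = l * a / 4 := by rw [hl]; field_simp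
    linarith [Real.add_one_le_exp (-(3 / 4 * l * a))]
  have h := measure_le_le_exp_mul_mgf (μ := μ) (X := ∑ i, Y i) (t := -l) (n * (a / 2))
    (by linarith) (integrable_exp_mul_sum_of_mem_Icc hm hindep hid i₀ hY _)
  rw [mgf_sum_of_identDistrib hm hindep (fun i _ j _ => hid i j) (Finset.mem_univ i₀)] at h
  simp only [Finset.sum_apply, Finset.card_univ, Fintype.card_fin] at h
  refine h.trans ?_
  calc _ ≤ Real.exp (-(-l) * (n * (a / 2))) * Real.exp (-(3 / 4 * l * a)) ^ n := by
        gcongr; exact mgf_nonneg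
    _ = Real.exp (-(n * (a ^ 2 / (16 * V)))) := by
        rw [← Real.exp_nat_mul, ← Real.exp_add, hl]
        congr 1
        field_simp
        ring

variable {n p q : ℕ} {X : Fin n → Ω → EuclideanSpace ℝ (Fin p)} {a₁ a₂ a₃ : ℝ}

/-- The cubes range up to `(a₃ √q)³`; this is the source of the rate `n / q^(3/2)`. -/
theorem measureReal_third_moment (hX : ∀ i, Measurable (X i)) (hindep : iIndepFun X μ)
    (hid : ∀ i j, IdentDistrib (X i) (X j) μ μ) (i₀ : Fin n) (hq : 1 ≤ q) (ha₃ : 0 < a₃)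
    (hA : CovariateAssumptions μ (X i₀) q a₁ a₂ a₃) {u : EuclideanSpace ℝ (Fin p)}
    (hu : IsSparse q u) (hu1 : ‖u‖ = 1) :
    μ.real {ω | n * (3 * a₂) ≤ ∑ i, |inner ℝ (X i ω) u| ^ 3} ≤
      Real.exp (-(n * (a₂ / (a₃ * √q) ^ 3))) := by
  have hg : Measurable fun x : EuclideanSpace ℝ (Fin p) => |inner ℝ x u| ^ 3 :=
    Continuous.measurable (by fun_prop)
  have hq0 : (0 : ℝ) < q := by exact_mod_cast hq
  refine measureReal_three_mul_le_sum (Y := fun i ω => |inner ℝ (X i ω) u| ^ 3)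
    (fun i => hg.comp (hX i)) (hindep.comp _ fun _ => hg) (fun i j => (hid i j).comp hg) i₀
    (by positivity) ?_ (hA.third_moment u hu1 hu)
  filter_upwards [ae_abs_inner_le ha₃ hA hu hu1] with ω hω
  exact ⟨by positivity, pow_le_pow_left₀ (abs_nonneg _) hω 3⟩

/-- The variance proxy is a fourth moment, controlled by `|y|⁴ ≤ a₃ √q |y|³`, so only a factor `√q`
is lost. -/
theorem measureReal_second_moment (hX : ∀ i, Measurable (X i)) (hindep : iIndepFun X μ)
    (hid : ∀ i j, IdentDistrib (X i) (X j) μ μ) (i₀ : Fin n) (hq : 1 ≤ q) (ha₁ : 0 < a₁)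
    (ha₂ : 0 < a₂) (ha₃ : 0 < a₃) (hA : CovariateAssumptions μ (X i₀) q a₁ a₂ a₃)
    {u : EuclideanSpace ℝ (Fin p)} (hu : IsSparse q u) (hu1 : ‖u‖ = 1) :
    μ.real {ω | ∑ i, inner ℝ (X i ω) u ^ 2 ≤ n * (a₁ / 2)} ≤
      Real.exp (-(n * (a₁ ^ 2 / (16 * (a₃ * √q * a₂))))) := by
  have hg : Measurable fun x : EuclideanSpace ℝ (Fin p) => inner ℝ x u ^ 2 :=
    Continuous.measurable (by fun_prop)
  have hq0 : (0 : ℝ) < q := by exact_mod_cast hq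
  have hb := ae_abs_inner_le ha₃ hA hu hu1
  refine measureReal_sum_le_half (Y := fun i ω => inner ℝ (X i ω) u ^ 2)
    (fun i => hg.comp (hX i)) (hindep.comp _ fun _ => hg) (fun i j => (hid i j).comp hg) i₀
    (M := (a₃ * √q) ^ 2) ha₁ (by positivity) ?_ (hA.second_moment u hu1 hu) ?_
  · filter_upwards [hb] with ω hω
    exact ⟨sq_nonneg _, by rw [← sq_abs]; exact pow_le_pow_left₀ (abs_nonneg _) hω 2⟩
  · have hi : Integrable (fun ω => |inner ℝ (X i₀ ω) u| ^ 3) μ := by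
      refine Integrable.of_mem_Icc 0 ((a₃ * √q) ^ 3)
        (Measurable.aemeasurable (Measurable.comp (g := fun x => |inner ℝ x u| ^ 3)
          (Continuous.measurable (by fun_prop)) (hX i₀))) ?_
      filter_upwards [hb] with ω hω
      exact ⟨by positivity, pow_le_pow_left₀ (abs_nonneg _) hω 3⟩
    calc ∫ ω, (inner ℝ (X i₀ ω) u ^ 2) ^ 2 ∂μ
        ≤ ∫ ω, a₃ * √q * |inner ℝ (X i₀ ω) u| ^ 3 ∂μ := by
          refine integral_mono_of_nonneg (Filter.Eventually.of_forall fun ω => by positivity)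
            (hi.const_mul _) ?_
          filter_upwards [hb] with ω hω
          rw [← sq_abs (inner ℝ (X i₀ ω) u), ← pow_mul, pow_succ' _ 3]
          gcongr
      _ ≤ a₃ * √q * a₂ := by
          rw [integral_const_mul]
          gcongr
          exact hA.third_moment u hu1 hu

end Tails

/-! ### Union bound over the net. -/

/-- The number of net vectors is absorbed by the exponential tail bound. -/
theorem card_net_mul_exp_le {n p q K : ℕ} {c : ℝ} (hc : 0 < c) (hp : 2 ≤ p) (hq : 1 ≤ q)
    (hK : 1 ≤ K) (hn : 2 * (6 + 6 * K) / c * (q : ℝ) ^ 3 * Real.log p ≤ n) :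
    ((p * (2 * (K * q) + 1) : ℕ) : ℝ) ^ q * (2 * Real.exp (-(n * (c / √q ^ 3)))) ≤
      Real.exp (-(c / 2 * (n / (q : ℝ) ^ 3))) := by
  set s := √(q : ℝ) with hs
  set l := Real.log p with hl
  have hq1 : (1 : ℝ) ≤ q := by exact_mod_cast hq
  have hK1 : (1 : ℝ) ≤ K := by exact_mod_cast hK
  have hp2 : (2 : ℝ) ≤ p := by exact_mod_cast hp
  have hs1 : 1 ≤ s := Real.one_le_sqrt.2 hq1
  have hs0 : 0 < s := by linarith
  have hsq : s ^ 2 = q := Real.sq_sqrt (by linarith)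
  have hl2 : Real.log 2 ≤ l := Real.log_le_log (by norm_num) hp2
  have hl0 : 1 / 2 ≤ l := by linarith [Real.log_two_gt_d9]
  -- Bounding `log q = 2 log s` by `2 s` suffices: `q · s = s³` is the order allowed for the log of
  -- the net size.
  have hlog : Real.log ((p * (2 * (K * q) + 1) : ℕ) : ℝ) ≤ l + 3 * K + 2 * s := by
    push_cast
    rw [Real.log_mul (by linarith) (by positivity)]
    have h1 : Real.log (2 * ((K : ℝ) * q) + 1) ≤ Real.log (3 * K * s ^ 2) := by
      rw [hsq]
      exact Real.log_le_log (by positivity) (by nlinarith)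
    rw [Real.log_mul (by positivity) (by positivity), Real.log_pow] at h1
    have h2 := Real.log_le_sub_one_of_pos hs0
    have h3 := Real.log_le_sub_one_of_pos (by positivity : 0 < 3 * (K : ℝ))
    push_cast at h1
    linarith
  have hN : 0 < ((p * (2 * (K * q) + 1) : ℕ) : ℝ) := by
    exact_mod_cast Nat.mul_pos (by omega) (by omega)
  have hs23 : s ^ 2 ≤ s ^ 3 := pow_le_pow_right₀ hs1 (by norm_num)
  have hs13 : 1 ≤ s ^ 3 := one_le_pow₀ hs1
  have hq3 : (q : ℝ) ^ 3 = s ^ 3 * s ^ 3 := by rw [← hsq]; ring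
  -- Half of the tail exponent absorbs the net; `l ≥ 1/2` lets constants be charged to `log p`.
  have hA : Real.log 2 + s ^ 2 * (l + 3 * K + 2 * s) ≤ n * (c / s ^ 3) / 2 := by
    have h1 : (6 + 6 * K) * s ^ 3 * l ≤ n * (c / s ^ 3) / 2 := by
      have h := mul_le_mul_of_nonneg_right hn (by positivity : 0 ≤ c / s ^ 3 / 2)
      rw [hq3] at h
      refine le_trans (le_of_eq ?_) (h.trans (le_of_eq (by ring)))
      field_simp
    have h2 : Real.log 2 ≤ s ^ 3 * l := by nlinarith
    have h3 : s ^ 2 * l ≤ s ^ 3 * l := by gcongr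
    have h4 : s ^ 2 * (3 * K) ≤ 6 * K * (s ^ 3 * l) := by
      have h5 : s ^ 2 ≤ 2 * (s ^ 3 * l) := by nlinarith
      nlinarith [mul_le_mul_of_nonneg_left h5 (by positivity : 0 ≤ 3 * (K : ℝ))]
    have h6 : 2 * s ^ 3 ≤ 4 * (s ^ 3 * l) := by nlinarith
    linarith
  -- The other half, of order `n / q^(3/2)`, is weakened to the stated `n / q³`.
  have hB : c / 2 * (n / (q : ℝ) ^ 3) ≤ n * (c / s ^ 3) / 2 := by
    rw [hq3]
    have h1 : (n : ℝ) / (s ^ 3 * s ^ 3) ≤ n / s ^ 3 := by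
      gcongr
      exact le_mul_of_one_le_left (by positivity) hs13
    have h2 := mul_le_mul_of_nonneg_left h1 (by positivity : 0 ≤ c / 2)
    linarith [show n * (c / s ^ 3) / 2 = c / 2 * (n / s ^ 3) by ring]
  calc _ = Real.exp (Real.log 2 + s ^ 2 * Real.log ((p * (2 * (K * q) + 1) : ℕ) : ℝ) +
          -(n * (c / s ^ 3))) := by
        rw [Real.exp_add, Real.exp_add, Real.exp_log two_pos, hsq, Real.exp_nat_mul,
          Real.exp_log hN]
        ring
    _ ≤ _ := by
        rw [Real.exp_le_exp]
        have := mul_le_mul_of_nonneg_left hlog (sq_nonneg s)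
        linarith

/-- The event that the empirical moment bounds fail in direction `v`. -/
def momentFailure {Ω : Type*} {n p : ℕ} (X : Fin n → Ω → EuclideanSpace ℝ (Fin p)) (a₁ a₂ : ℝ)
    (v : EuclideanSpace ℝ (Fin p)) : Set Ω :=
  {ω | n * (3 * a₂) * ‖v‖ ^ 3 < ∑ i, |inner ℝ (X i ω) v| ^ 3} ∪
    {ω | ∑ i, inner ℝ (X i ω) v ^ 2 < n * (a₁ / 2) * ‖v‖ ^ 2}

/-- Passing from the net to all sparse vectors turns the thresholds `3 a₂` and `a₁ / 2` into `64 (3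
a₂)` and `(a₁ / 2) / 16`, which explains the constants; `hKa` makes the net fine enough. -/
theorem compl_iUnion_momentFailure_subset {Ω : Type*} {n p q K : ℕ}
    {X : Fin n → Ω → EuclideanSpace ℝ (Fin p)} {a₁ a₂ : ℝ} (hn : 0 < n) (hp : 0 < p) (hq : 1 ≤ q)
    (hK : 2 ≤ K) (ha₁ : 0 < a₁) (ha₂ : 0 < a₂)
    (hKa : 16 * (1 + 64 * (3 * a₂)) ≤ a₁ / 2 * (K : ℝ) ^ 2) :
    (⋃ idx, momentFailure X a₁ a₂ (netVec q K idx))ᶜ ⊆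
      {ω | HessianConditions (fun i => X i ω) q
        (fun r => cumulantSecond (2 * (64 * (3 * a₂)) / (a₁ / 2 / 16) * r) * (a₁ / 2 / 16 / 2))
        (fun r => 1 + 64 * (3 * a₂) + r) (64 * (3 * a₂))} := by
  intro ω hω
  simp only [momentFailure, Set.compl_iUnion, Set.compl_union, Set.mem_iInter, Set.mem_inter_iff,
    Set.mem_compl_iff, Set.mem_ofPred_eq, not_lt] at hω
  have h3 := third_moment_of_net (x := fun i => X i ω) hp hq hK (by positivity)
    fun idx => (hω idx).1
  exact hessianConditions_of_moments hn (by positivity) (by positivity) h3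
    (second_moment_of_net hp hq hK (by positivity) (by positivity) hKa h3 fun idx => (hω idx).2)

section Union

variable {Ω : Type*} [MeasurableSpace Ω] {μ : Measure Ω} [IsProbabilityMeasure μ]
  {n p q : ℕ} {X : Fin n → Ω → EuclideanSpace ℝ (Fin p)} {a₁ a₂ a₃ : ℝ}

theorem measureReal_momentFailure_le (hX : ∀ i, Measurable (X i)) (hindep : iIndepFun X μ)
    (hid : ∀ i j, IdentDistrib (X i) (X j) μ μ) (i₀ : Fin n) (hq : 1 ≤ q) (ha₁ : 0 < a₁)
    (ha₂ : 0 < a₂) (ha₃ : 0 < a₃) (hA : CovariateAssumptions μ (X i₀) q a₁ a₂ a₃)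
    {v : EuclideanSpace ℝ (Fin p)} (hv : IsSparse q v) :
    μ.real (momentFailure X a₁ a₂ v) ≤
      2 * Real.exp (-(n * (min (a₂ / a₃ ^ 3) (a₁ ^ 2 / (16 * (a₃ * a₂))) / √q ^ 3))) := by
  -- Net vectors may vanish; the strict homogeneous inequalities never hold at `0`. Others are
  -- rescaled to unit vectors.
  rcases eq_or_ne v 0 with rfl | hv0
  · have : momentFailure X a₁ a₂ 0 = ∅ := by simp [momentFailure]
    rw [this, measureReal_empty]
    positivity
  have hv' : 0 < ‖v‖ := norm_pos_iff.2 hv0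
  have hs1 : 1 ≤ √(q : ℝ) := Real.one_le_sqrt.2 (by exact_mod_cast hq)
  set u := ‖v‖⁻¹ • v with hu
  have hus : IsSparse q u := hv.smul _
  have hu1 : ‖u‖ = 1 := by simp [hu, norm_smul, hv0]
  have hvu : v = ‖v‖ • u := by rw [hu, smul_smul, mul_inv_cancel₀ hv'.ne', one_smul]
  have hsub : momentFailure X a₁ a₂ v ⊆
      {ω | n * (3 * a₂) ≤ ∑ i, |inner ℝ (X i ω) u| ^ 3} ∪
        {ω | ∑ i, inner ℝ (X i ω) u ^ 2 ≤ n * (a₁ / 2)} := by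
    refine Set.union_subset_union (fun ω hω => ?_) fun ω hω => ?_
    · have h : n * (3 * a₂) * ‖v‖ ^ 3 < ∑ i, |inner ℝ (X i ω) (‖v‖ • u)| ^ 3 := by
        rw [← hvu]; exact hω
      simp only [inner_smul_right, abs_mul, abs_norm, mul_pow] at h
      rw [← Finset.mul_sum, mul_comm] at h
      exact (lt_of_mul_lt_mul_left h (by positivity)).le
    · have h : ∑ i, inner ℝ (X i ω) (‖v‖ • u) ^ 2 < n * (a₁ / 2) * ‖v‖ ^ 2 := by
        rw [← hvu]; exact hω
      simp only [inner_smul_right, mul_pow] at h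
      rw [← Finset.mul_sum, mul_comm (_ * _)] at h
      exact (lt_of_mul_lt_mul_left h (by positivity)).le
  refine (measureReal_mono hsub).trans ((measureReal_union_le _ _).trans ?_)
  rw [two_mul]
  refine add_le_add ((measureReal_third_moment hX hindep hid i₀ hq ha₃ hA hus hu1).trans ?_)
    ((measureReal_second_moment hX hindep hid i₀ hq ha₁ ha₂ ha₃ hA hus hu1).trans ?_)
  · rw [Real.exp_le_exp, neg_le_neg_iff, mul_pow,
      ← div_div a₂ (a₃ ^ 3)]
    gcongr
    exact min_le_left _ _
  · rw [Real.exp_le_exp, neg_le_neg_iff,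
      show 16 * (a₃ * √(q : ℝ) * a₂) = 16 * (a₃ * a₂) * √(q : ℝ) by ring,
      ← div_div (a₁ ^ 2) (16 * (a₃ * a₂))]
    gcongr
    · exact min_le_right _ _
    · exact le_self_pow₀ hs1 (by norm_num)

theorem measureReal_iUnion_momentFailure_le {K : ℕ} (hX : ∀ i, Measurable (X i))
    (hindep : iIndepFun X μ) (hid : ∀ i j, IdentDistrib (X i) (X j) μ μ) (i₀ : Fin n)
    (hp : 2 ≤ p) (hq : 1 ≤ q) (hK : 1 ≤ K) (ha₁ : 0 < a₁) (ha₂ : 0 < a₂) (ha₃ : 0 < a₃)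
    (hA : CovariateAssumptions μ (X i₀) q a₁ a₂ a₃) {c : ℝ}
    (hc : c = min (a₂ / a₃ ^ 3) (a₁ ^ 2 / (16 * (a₃ * a₂))))
    (hn : 2 * (6 + 6 * K) / c * (q : ℝ) ^ 3 * Real.log p ≤ n) :
    μ.real (⋃ idx, momentFailure X a₁ a₂ (netVec q K idx)) ≤
      Real.exp (-(c / 2 * (n / (q : ℝ) ^ 3))) := by
  have hc0 : 0 < c := by rw [hc]; positivity
  refine (measureReal_iUnion_fintype_le _).trans (le_trans ?_
    (card_net_mul_exp_le hc0 hp hq hK hn))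
  refine (Finset.sum_le_card_nsmul _ _ _ fun idx _ => measureReal_momentFailure_le hX hindep hid
    i₀ hq ha₁ ha₂ ha₃ hA (isSparse_netVec q K idx)).trans (le_of_eq ?_)
  rw [← hc, nsmul_eq_mul]
  simp

end Union

end SparseLogistic

/-! ### Choice of constants and conclusion. -/

theorem mainTheorem1 (a₁ a₂ a₃ : ℝ) (ha₁ : 0 < a₁) (ha₂ : 0 < a₂) (ha₃ : 0 < a₃) :
    ∃ (cSample cChange cProb : ℝ) (cLower cUpper : ℝ → ℝ),
      0 < cSample ∧ 0 < cChange ∧ 0 < cProb ∧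
      StrictAntiOn cLower (Set.Ici 0) ∧ (∀ r : ℝ, 0 ≤ r → 0 < cLower r) ∧
      StrictMonoOn cUpper (Set.Ici 0) ∧ (∀ r : ℝ, 0 ≤ r → 0 < cUpper r) ∧
      ∀ (n p q : ℕ) (hn : 2 ≤ n) (_hp : 2 ≤ p) (_hq : 1 ≤ q)
        (Ω : Type*) [MeasurableSpace Ω] (μ : Measure Ω) [IsProbabilityMeasure μ]
        (X : Fin n → Ω → EuclideanSpace ℝ (Fin p)),
        (∀ i, Measurable (X i)) →
        iIndepFun X μ →
        (∀ i j, IdentDistrib (X i) (X j) μ μ) →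
        SparseLogistic.CovariateAssumptions μ (X ⟨0, by omega⟩) q a₁ a₂ a₃ →
        cSample * (q : ℝ) ^ 3 * Real.log (p : ℝ) ≤ (n : ℝ) →
        MeasurableSet {ω | SparseLogistic.HessianConditions (fun i => X i ω) q
          cLower cUpper cChange} ∧
        1 - Real.exp (-(cProb * ((n : ℝ) / (q : ℝ) ^ 3))) ≤
          μ.real {ω | SparseLogistic.HessianConditions (fun i => X i ω) q
            cLower cUpper cChange} := by
  -- The fineness `K` depends only on `a₁` and `a₂`, so every constant built from it is uniform in
  -- `n`, `p`, `q`.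
  obtain ⟨K, hK2, hKa⟩ : ∃ K : ℕ, 2 ≤ K ∧
      16 * (1 + 64 * (3 * a₂)) ≤ a₁ / 2 * (K : ℝ) ^ 2 := by
    obtain ⟨K, hK⟩ := exists_nat_ge (16 * (1 + 64 * (3 * a₂)) / (a₁ / 2))
    refine ⟨K + 2, by omega, ?_⟩
    rw [div_le_iff₀ (by positivity)] at hK
    push_cast
    nlinarith [mul_nonneg ha₁.le (Nat.cast_nonneg K : (0 : ℝ) ≤ K),
      mul_nonneg ha₁.le (sq_nonneg (K : ℝ))]
  -- The smaller of the rates of the third- and second-moment tails.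
  obtain ⟨c, hc⟩ : ∃ c, c = min (a₂ / a₃ ^ 3) (a₁ ^ 2 / (16 * (a₃ * a₂))) := ⟨_, rfl⟩
  have hc0 : 0 < c := by rw [hc]; positivity
  refine ⟨2 * (6 + 6 * K) / c, 64 * (3 * a₂), c / 2,
    fun r => SparseLogistic.cumulantSecond (2 * (64 * (3 * a₂)) / (a₁ / 2 / 16) * r) *
      (a₁ / 2 / 16 / 2), fun r => 1 + 64 * (3 * a₂) + r, by positivity, by positivity,
    by positivity, ?_, ?_, ?_, ?_, ?_⟩
  · intro r hr t ht hrt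
    have h0 : 0 < 2 * (64 * (3 * a₂)) / (a₁ / 2 / 16) := by positivity
    exact mul_lt_mul_of_pos_right (SparseLogistic.strictAntiOn_cumulantSecond
      (mul_nonneg h0.le hr) (mul_nonneg h0.le ht) (mul_lt_mul_of_pos_left hrt h0))
      (by positivity)
  · exact fun r _ => mul_pos (SparseLogistic.cumulantSecond_pos _) (by positivity)
  · exact fun r _ t _ hrt => add_lt_add_right hrt _
  · intro r hr
    positivity
  intro n p q hn hp hq Ω _ μ _ X hX hindep hid hA hsample
  have hmeas := (SparseLogistic.isClosed_hessianConditions n p q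
    (fun r => SparseLogistic.cumulantSecond (2 * (64 * (3 * a₂)) / (a₁ / 2 / 16) * r) *
      (a₁ / 2 / 16 / 2)) (fun r => 1 + 64 * (3 * a₂) + r) (64 * (3 * a₂))).measurableSet.preimage
    (measurable_pi_iff.2 hX)
  refine ⟨hmeas, ?_⟩
  have h1 := SparseLogistic.measureReal_iUnion_momentFailure_le hX hindep hid ⟨0, by omega⟩ hp hq
    (by omega) ha₁ ha₂ ha₃ hA hc hsample
  have h2 := measureReal_mono (μ := μ) (Set.compl_subset_comm.1
    (SparseLogistic.compl_iUnion_momentFailure_subset (X := X) (by omega : 0 < n)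
      (by omega) hq hK2 ha₁ ha₂ hKa))
  have h3 := probReal_compl_eq_one_sub (μ := μ) hmeas
  exact sub_le_comm.1 (h3.symm.le.trans (h2.trans h1))
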